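/- **Setting.** Let $(I,\preceq)$ be a finite partially ordered set and let $\mathcal A=\prod_{i,j\in I}\mathcal A_{ij}$ be a Vinberg algebra over $I$. That is, the $\mathcal A_{ij}$ are finite-dimensional real vector spaces with $\mathcal A_{ii}=\mathbb R$, $\mathcal A_{ij}=\mathcal A_{ji}=E_{ij}\neq\{0\}$ for $j\prec i$, and $\mathcal A_{ij}=\{0\}$ if $i,j$ are incomparable; the elements $A=(a_{ij})$ are regarded as matrices, $\operatorname{tr}A=\sum_i a_{ii}$; there are bilinear maps $\mathcal A_{ij}\times\mathcal A_{jk}\to\mathcal A_{ik}$ defining the product $(AB)_{ij}=\sum_\mu a_{i\mu}b_{\mu j}$, for which $e=\operatorname{diag}(1)$ is a two-sided unit, and a linear involution $A\mapsto A^*$ exchanging $\mathcal A_{ij}$ and $\mathcal A_{ji}$ and fixing diagonal entries. With $\mathcal T_l=\{A:\ a_{ij}=0 \text{ unless } j\preceq i\}$ the following hold: $\operatorname{tr}(AA^*)>0$ for $A\ne0$; $(AB)^*=B^*A^*$; $\operatorname{tr}(AB)=\operatorname{tr}(BA)$; $\operatorname{tr}(A(BC))=\operatorname{tr}((AB)C)$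 for $A,B,C\in\mathcal A$; and $(ST)U=S(TU)$, $T(UU^*)=(TU)U^*$ for $S,T,U\in\mathcal T_l$. For $j\prec i$ the space $E_{ij}$ carries the Euclidean norm $\|a\|^2=aa^*$ and the corresponding Lebesgue measure, and $n_{ij}=\dim E_{ij}$. Let $\mathcal T_l^+$ be the set of $T\in\mathcal T_l$ with $t_{ii}>0$ for all $i$. An element $X=TT^*$ with $T\in\mathcal T_l^+$ determines $T$; put $\Delta_{\preceq k}(X)=\prod_{j\preceq k}t_{jj}^2$, $\Delta_{\prec k}(X)=\prod_{j\prec k}t_{jj}^2$ and, for $i\in I$ and $\chi=(\lambda_j)_{j\in I}\in\mathbb R^I$, $$\Delta^{(i)}_\chi(X)=\prod_{k\succeq i}\Big(\frac{\Delta_{\preceq k}(X)}{\Delta_{\prec k}(X)}\Big)^{\lambda_k}.$$ Let $i\in I$, let $\psi:I\to\{0,1\}$ be a map with $\psi(j)=0$ unless $i\preceq j$, and put $e_\psi=\operatorname{diag}(\psi)$, $T\cdot e_\psi=Te_\psi T^*$, $\mathcal T_l^+\cdot e_\psi=\{T\cdot e_\psi:\ T\in\mathcal T_l^+\}$, $$n^i_j=\sum_{k\prec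 j}\psi(k)\,n_{jk},\qquad |\psi|=\sum_{j\succeq i}\psi(j),\qquad |n^\psi|=\sum_{j\succeq i}n^i_j .$$ Let $\chi_i=(\lambda_j)_{j\in I}\in\mathbb R^I$ with $\lambda_j=0$ whenever $i\not\preceq j$ or $\psi(j)=0$, and define $\Delta^\psi_{\chi_i}(T\cdot e_\psi)=\Delta^{(i)}_{\chi_i}(TT^*)$ for $T\in\mathcal T_l^+$. Let $\nu_\psi$ be the measure on $\mathcal T_l^+\cdot e_\psi$ given, for $\psi\neq0$, by $$\nu_\psi(d(T\cdot e_\psi))=\Delta^{(i)}_{\dot\chi}(TT^*)\prod_{i\preceq j\preceq k,\ \psi(j)=1}dt_{kj},$$ where $\dot\chi=(\dot\lambda_j)$ with $\dot\lambda_j=-\psi(j)(1+n^i_j)/2$ if $i\preceq j$ and $\dot\lambda_j=0$ otherwise, and let $\nu_0$ be the Dirac measure at $0$. **Theorem 3.2.** The integral $$\Gamma_{\mathcal T_l^+\cdot e_\psi}(\chi_i)=\int_{\mathcal T_l^+\cdot e_\psi}e^{-\operatorname{tr}Z}\,\Delta^\psi_{\chi_i}(Z)\,\nu_\psi(dZ)$$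 converges if and only if $\lambda_j>n^i_j/2$ for all $j\in I$ with $\psi(j)=1$. In this case $$\Gamma_{\mathcal T_l^+\cdot e_\psi}(\chi_i)=2^{-|\psi|}\,\pi^{|n^\psi|/2}\prod_{j\in I,\ \psi(j)=1}\Gamma\Big(\lambda_j-\frac{n^i_j}{2}\Big).$$ -/

import Mathlib

noncomputable section

open scoped Classical

namespace Vinberg

section Algebra

variable {I : Type*} [Fintype I] [PartialOrder I]
  {A : I → I → Type*} [∀ i j, NormedAddCommGroup (A i j)] [∀ i j, InnerProductSpace ℝ (A i j)]

/-- The raw operations on a family `A i j` of matrix entries: the identification of the diagonal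
entries with `ℝ`, the adjunction `A i j → A j i`, and the partial products
`A i j × A j k → A i k`. -/
structure Ops (I : Type*) [Fintype I] [PartialOrder I] (A : I → I → Type*)
    [∀ i j, NormedAddCommGroup (A i j)] [∀ i j, InnerProductSpace ℝ (A i j)] where
  scalar : ∀ i, A i i ≃ₗ[ℝ] ℝ
  adj : ∀ i j, A i j →ₗ[ℝ] A j i
  emul : ∀ i j k, A i j →ₗ[ℝ] A j k →ₗ[ℝ] A i k

/-- The space `𝒜 = ∏_{i,j} A i j` of generalized matrices. -/
abbrev Mat {I : Type*} (A : I → I → Type*) := ∀ i j, A i j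

namespace Ops

variable (O : Ops I A)

/-- The product `(X Y)_{ij} = ∑_μ x_{iμ} y_{μj}`. -/
def mul (X Y : Mat A) : Mat A := fun i j => ∑ m, O.emul i m j (X i m) (Y m j)

/-- The adjoint matrix `X ↦ X^*`. -/
def star (X : Mat A) : Mat A := fun i j => O.adj j i (X j i)

/-- The trace `∑_i x_{ii}`. -/
def tr (X : Mat A) : ℝ := ∑ i, O.scalar i (X i i)

/-- The diagonal matrix with diagonal entries `d i`. -/
def diag (d : I → ℝ) : Mat A := fun i => Pi.single i ((O.scalar i).symm (d i))

/-- The diagonal matrix with all diagonal entries equal to `1`. -/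
def one : Mat A := O.diag fun _ => 1

end Ops

/-- The lower triangular matrices `𝒯_l`. -/
def lowerTri (A : I → I → Type*) [∀ i j, NormedAddCommGroup (A i j)] : Set (Mat A) :=
  {T | ∀ i j, ¬ j ≤ i → T i j = 0}

end Algebra

/-- A Vinberg algebra over the finite poset `I`. The spaces `A i j` and `A j i`, `j < i`, are two
copies of one space `E_{ij}`; the adjunction `A i j → A j i` carries the involution of `E_{ij}`.
The norm of `A i j` carries no extra information: by `inner_eq` it is the one given by
`‖a‖² = a a^*`. -/
structure Algebra (I : Type*) [Fintype I] [PartialOrder I] (A : I → I → Type*)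
    [∀ i j, NormedAddCommGroup (A i j)] [∀ i j, InnerProductSpace ℝ (A i j)]
    extends Ops I A where
  entry_trivial : ∀ i j, ¬ i ≤ j → ¬ j ≤ i → Subsingleton (A i j)
  entry_nontrivial : ∀ i j, j < i → Nontrivial (A i j)
  adj_adj : ∀ i j (a : A i j), adj j i (adj i j a) = a
  adj_diag : ∀ i (a : A i i), adj i i a = a
  inner_eq : ∀ i j (a b : A i j), inner ℝ a b = scalar i (emul i j i a (adj i j b))
  one_mul : ∀ X : Mat A, toOps.mul toOps.one X = X
  mul_one : ∀ X : Mat A, toOps.mul X toOps.one = X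
  tr_pos : ∀ X : Mat A, X ≠ 0 → 0 < toOps.tr (toOps.mul X (toOps.star X))
  star_mul : ∀ X Y : Mat A,
    toOps.star (toOps.mul X Y) = toOps.mul (toOps.star Y) (toOps.star X)
  tr_comm : ∀ X Y : Mat A, toOps.tr (toOps.mul X Y) = toOps.tr (toOps.mul Y X)
  tr_assoc : ∀ X Y Z : Mat A,
    toOps.tr (toOps.mul X (toOps.mul Y Z)) = toOps.tr (toOps.mul (toOps.mul X Y) Z)
  lower_assoc : ∀ U ∈ lowerTri A, ∀ S ∈ lowerTri A, ∀ T ∈ lowerTri A,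
    toOps.mul (toOps.mul S T) U = toOps.mul S (toOps.mul T U)
  lower_star_assoc : ∀ U ∈ lowerTri A, ∀ T ∈ lowerTri A,
    toOps.mul T (toOps.mul U (toOps.star U)) = toOps.mul (toOps.mul T U) (toOps.star U)

namespace Algebra

variable {I : Type*} [Fintype I] [PartialOrder I]
  {A : I → I → Type*} [∀ i j, NormedAddCommGroup (A i j)] [∀ i j, InnerProductSpace ℝ (A i j)]
  (V : Algebra I A)

/-- The group `𝒯_l^+` of lower triangular matrices with positive diagonal. -/
def lowerTriPos : Set (Mat A) := {T | T ∈ lowerTri A ∧ ∀ i, 0 < V.scalar i (T i i)}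

/-- The homogeneous cone `𝒫 = {T T^* : T ∈ 𝒯_l^+}`. -/
def cone : Set (Mat A) := {X | ∃ T ∈ V.lowerTriPos, X = V.mul T (V.star T)}

/-- The triangular factor `T ∈ 𝒯_l^+` of `X = T T^* ∈ 𝒫` (`0` outside the cone). -/
def factor (X : Mat A) : Mat A :=
  if h : X ∈ V.cone then Exists.choose h else 0

/-- The large principal minor `Δ_{≼k}(T T^*) = ∏_{j ≼ k} t_{jj}^2`. -/
def minorLE (k : I) (X : Mat A) : ℝ :=
  ∏ j with j ≤ k, V.scalar j (V.factor X j j) ^ 2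

/-- The strict principal minor `Δ_{≺k}(T T^*) = ∏_{j ≺ k} t_{jj}^2`. -/
def minorLT (k : I) (X : Mat A) : ℝ :=
  ∏ j with j < k, V.scalar j (V.factor X j j) ^ 2

/-- The generalized power `Δ_χ^{(i)}(X) = ∏_{i ≼ k} (Δ_{≼k}(X) / Δ_{≺k}(X)) ^ λ_k` of the
multiplier `χ = (λ_k)`. -/
def genPow (i : I) (χ : I → ℝ) (X : Mat A) : ℝ :=
  ∏ k with i ≤ k, (V.minorLE k X / V.minorLT k X) ^ χ k

/-- The diagonal matrix `e_ψ = diag ψ`. -/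
def ePsi (ψ : I → Fin 2) : Mat A := V.diag fun j => ((ψ j : ℕ) : ℝ)

/-- `T · e_ψ = T e_ψ T^*`. -/
def act (ψ : I → Fin 2) (T : Mat A) : Mat A := V.mul (V.mul T (V.ePsi ψ)) (V.star T)

/-- The orbit `𝒯_l^+ · e_ψ`. -/
def orbit (ψ : I → Fin 2) : Set (Mat A) := {Z | ∃ T ∈ V.lowerTriPos, Z = V.act ψ T}

/-- The generalized power on the orbit, `Δ_χ^ψ(T · e_ψ) = Δ_χ^{(i)}(T T^*)` for `T ∈ 𝒯_l^+`
(`0` outside the orbit). -/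
def orbitPow (i : I) (ψ : I → Fin 2) (χ : I → ℝ) (Z : Mat A) : ℝ :=
  if h : Z ∈ V.orbit ψ then
    V.genPow i χ (V.mul (Exists.choose h) (V.star (Exists.choose h)))
  else 0

end Algebra

section Parameters

variable {I : Type*} [Fintype I] [PartialOrder I]

/-- The set `𝒳(ψ)` of multipliers `χ_i = (λ_j)` with `λ_j = 0` if `i ⋠ j`, and also if `i ≼ j`
and `ψ j = 0`. -/
def multipliers (i : I) (ψ : I → Fin 2) : Set (I → ℝ) :=
  {χ | (∀ j, ¬ i ≤ j → χ j = 0) ∧ ∀ j, i ≤ j → ψ j = 0 → χ j = 0}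

/-- `n_j^i = ∑_{k ≺ j} ψ(k) dim E_{jk}`. -/
def nPsi (A : I → I → Type*) [∀ i j, NormedAddCommGroup (A i j)]
    [∀ i j, InnerProductSpace ℝ (A i j)] (ψ : I → Fin 2) (j : I) : ℕ :=
  ∑ k with k < j, (ψ k : ℕ) * Module.finrank ℝ (A j k)

/-- `|ψ| = ∑_{i ≼ j} ψ(j)`. -/
def absPsi (i : I) (ψ : I → Fin 2) : ℕ := ∑ j with i ≤ j, (ψ j : ℕ)

/-- `|n^ψ| = ∑_{i ≼ j} n_j^i`. -/
def absN (A : I → I → Type*) [∀ i j, NormedAddCommGroup (A i j)]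
    [∀ i j, InnerProductSpace ℝ (A i j)] (i : I) (ψ : I → Fin 2) : ℕ :=
  ∑ j with i ≤ j, nPsi A ψ j

/-- The multiplier with `λ_j = -ψ(j) (1 + n_j^i) / 2` if `i ≼ j` and `λ_j = 0` otherwise. -/
def dotChi (A : I → I → Type*) [∀ i j, NormedAddCommGroup (A i j)]
    [∀ i j, InnerProductSpace ℝ (A i j)] (i : I) (ψ : I → Fin 2) (j : I) : ℝ :=
  if i ≤ j then -((ψ j : ℕ) : ℝ) * (1 + (nPsi A ψ j : ℝ)) / 2 else 0

/-- The index set `{(k, j) : i ≼ j ≼ k, ψ(j) = 1}` of the coordinates `t_{kj}`. -/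
abbrev CoordIdx (i : I) (ψ : I → Fin 2) : Type _ :=
  {p : I × I // i ≤ p.2 ∧ p.2 ≤ p.1 ∧ ψ p.2 = 1}

/-- The space of the coordinates `t_{kj}`, `i ≼ j ≼ k`, `ψ(j) = 1`. -/
abbrev Coord (A : I → I → Type*) (i : I) (ψ : I → Fin 2) : Type _ :=
  ∀ p : CoordIdx i ψ, A p.1.1 p.1.2

end Parameters

namespace Algebra

variable {I : Type*} [Fintype I] [PartialOrder I]
  {A : I → I → Type*} [∀ i j, NormedAddCommGroup (A i j)] [∀ i j, InnerProductSpace ℝ (A i j)]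
  (V : Algebra I A)

/-- The matrix with the given coordinates `t_{kj}`, `i ≼ j ≼ k`, `ψ(j) = 1`, and with the entries
of the unit matrix elsewhere. (If `ψ` vanishes off `{j : i ≼ j}`, then `T · e_ψ` does not depend
on the other entries of the lower triangular matrix `T`.) -/
def ofCoord (i : I) (ψ : I → Fin 2) (t : Coord A i ψ) : Mat A :=
  fun k j => if h : i ≤ j ∧ j ≤ k ∧ ψ j = 1 then t ⟨(k, j), h⟩ else V.one k j

/-- The coordinates with `t_{jj} > 0` for all `j` with `i ≼ j` and `ψ(j) = 1`. -/
def posCoord (i : I) (ψ : I → Fin 2) : Set (Coord A i ψ) :=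
  {t | ∀ j (hi : i ≤ j) (hψ : ψ j = 1), 0 < V.scalar j (t ⟨(j, j), hi, le_refl j, hψ⟩)}

/-- The measure `ν_ψ(d(T · e_ψ)) = Δ_{χ̇}^{(i)}(T T^*) ∏_{i ≼ j ≼ k, ψ(j) = 1} dt_{kj}` on the
orbit of `e_ψ` if `ψ ≠ 0`, and the Dirac measure at `0` if `ψ = 0`. Here `dt_{kj}` is the Lebesgue
measure of the Euclidean space `A k j`. -/
def nu [∀ i j, FiniteDimensional ℝ (A i j)] [∀ i j, MeasurableSpace (A i j)]
    [∀ i j, BorelSpace (A i j)] (i : I) (ψ : I → Fin 2) : MeasureTheory.Measure (Mat A) :=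
  if ψ = 0 then MeasureTheory.Measure.dirac 0
  else
    (((MeasureTheory.volume : MeasureTheory.Measure (Coord A i ψ)).restrict
      (V.posCoord i ψ)).withDensity fun t => ENNReal.ofReal
        (V.genPow i (dotChi A i ψ) (V.mul (V.ofCoord i ψ t) (V.star (V.ofCoord i ψ t))))).map
      fun t => V.act ψ (V.ofCoord i ψ t)

end Algebra

end Vinberg

end

/-!
Since `tr (a a^*) = ‖a‖²`, in the coordinates `t_{kj}`, `i ≼ j ≼ k`, `ψ(j) = 1`, of the orbit the
trace of `T · e_ψ` is the sum of the `‖t_{kj}‖²`, and the generalized powers are monomials in the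
diagonal coordinates `t_{jj}`. Hence the integral factors: an off-diagonal coordinate contributes
the Gaussian integral `π ^ (n_{kj} / 2)`, and a diagonal one contributes
`∫_0^∞ e^{-s²} s^{2 λ_j - 1 - n_j} ds = Γ(λ_j - n_j / 2) / 2`.

The coordinates are well defined because the columns of `T` with `ψ(j) = 1` can be recovered one
after the other from `T · e_ψ`, as in the Cholesky decomposition.
-/

open MeasureTheory

section FiniteProducts

variable {ι M : Type*} [Fintype ι] [PartialOrder ι] [CommMonoid M]

open Classical in
@[to_additive]
theorem prod_filter_le_eq_mul_prod_filter_lt (f : ι → M) (k : ι) :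
    ∏ j with j ≤ k, f j = f k * ∏ j with j < k, f j := by
  rw [← Finset.prod_insert (by simp)]
  congr 1
  ext j
  simp [le_iff_eq_or_lt]

open Classical in
theorem prod_filter_ge_eq_mul_prod_filter_gt (f : ι → M) (k : ι) :
    ∏ j with k ≤ j, f j = f k * ∏ j with k < j, f j :=
  prod_filter_le_eq_mul_prod_filter_lt (ι := ιᵒᵈ) f k

end FiniteProducts

section ProductIntegrals

theorem lintegral_fin_prod_eq_prod {n : ℕ} {E : Fin n → Type*}
    {mE : ∀ i, MeasurableSpace (E i)} {μ : (i : Fin n) → Measure (E i)} [∀ i, SigmaFinite (μ i)]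
    {f : (i : Fin n) → E i → ENNReal} (hf : ∀ i, Measurable (f i)) :
    ∫⁻ x : (i : Fin n) → E i, ∏ i, f i (x i) ∂(Measure.pi μ) = ∏ i, ∫⁻ x, f i x ∂(μ i) := by
  induction n with
  | zero => simp
  | succ n ih =>
    rw [← ((measurePreserving_piFinSuccAbove μ 0).symm).lintegral_comp_emb
      (MeasurableEquiv.measurableEmbedding _)]
    simp_rw [MeasurableEquiv.piFinSuccAbove_symm_apply, Fin.insertNthEquiv,
      Fin.prod_univ_succ, Fin.insertNth_zero]
    simp only [Fin.zero_succAbove]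
    rw [← ih fun i => hf i.succ]
    exact lintegral_prod_mul (μ := μ 0) (ν := Measure.pi fun j : Fin n => μ j.succ)
      (hf 0).aemeasurable
      (Finset.measurable_prod _ fun (i : Fin n) _ =>
        (hf i.succ).comp (measurable_pi_apply i)).aemeasurable

variable {ι : Type*} [Fintype ι] {E : ι → Type*} {mE : ∀ i, MeasurableSpace (E i)}
  {μ : (i : ι) → Measure (E i)} [∀ i, SigmaFinite (μ i)]

theorem lintegral_fintype_prod_eq_prod {f : (i : ι) → E i → ENNReal}
    (hf : ∀ i, Measurable (f i)) :
    ∫⁻ x : (i : ι) → E i, ∏ i, f i (x i) ∂(Measure.pi μ) = ∏ i, ∫⁻ x, f i x ∂(μ i) := by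
  let e := (Fintype.equivFin ι).symm
  rw [← (measurePreserving_piCongrLeft _ e).lintegral_comp_emb
    (MeasurableEquiv.measurableEmbedding _)]
  simp_rw [← e.prod_comp, MeasurableEquiv.coe_piCongrLeft, Equiv.piCongrLeft_apply_apply]
  exact lintegral_fin_prod_eq_prod fun i => hf _

theorem integrable_fintype_prod_iff {𝕜 : Type*} [RCLike 𝕜] {f : (i : ι) → E i → 𝕜}
    (hf : ∀ i, Measurable (f i)) (hne : ∀ i, ¬ f i =ᵐ[μ i] 0) :
    Integrable (fun x : (i : ι) → E i => ∏ i, f i (x i)) (Measure.pi μ) ↔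
      ∀ i, Integrable (f i) (μ i) := by
  refine ⟨fun h i => ⟨(hf i).aestronglyMeasurable, ?_⟩, fun h => Integrable.fintype_prod_dep h⟩
  have hprod : ∏ j, ∫⁻ x, ‖f j x‖ₑ ∂(μ j) < ⊤ := by
    rw [← lintegral_fintype_prod_eq_prod fun j => (hf j).enorm]
    simpa only [HasFiniteIntegral, enorm, nnnorm_prod, ENNReal.ofNNReal_finsetProd] using h.2
  have hfactor (j : ι) : ∫⁻ x, ‖f j x‖ₑ ∂(μ j) ≠ 0 := fun h0 => hne j <| by
    filter_upwards [(lintegral_eq_zero_iff (hf j).enorm).1 h0] with x hx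
    simpa using hx
  exact lt_top_iff_ne_top.2 fun hi =>
    hprod.ne (WithTop.prod_eq_top (Finset.mem_univ i) hi fun j _ => hfactor j)

end ProductIntegrals

section ChangeOfVariables

variable {X Y : Type*} [MeasurableSpace X] [MeasurableSpace Y] {μ : Measure X} {F : X → Y}
  {P : Set X}

theorem map_restrict_eq_map_comap (hF : Measurable F) (hP : MeasurableSet P) :
    (μ.restrict P).map F = (μ.comap ((↑) : P → X)).map (P.domRestrict F) := by
  rw [← map_comap_subtype_coe hP, Measure.map_map hF measurable_subtype_coe]
  rfl

variable [StandardBorelSpace X] [MeasurableSpace.CountablySeparated Y]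

theorem measurableEmbedding_domRestrict_of_injOn (hF : Measurable F) (hP : MeasurableSet P)
    (hinj : Set.InjOn F P) : MeasurableEmbedding (P.domRestrict F) :=
  have : StandardBorelSpace P := hP.standardBorel
  (hF.comp measurable_subtype_coe).measurableEmbedding hinj.injective

theorem integrable_map_restrict_iff (hF : Measurable F) (hP : MeasurableSet P)
    (hinj : Set.InjOn F P) (f : Y → ℝ) :
    Integrable f ((μ.restrict P).map F) ↔ IntegrableOn (f ∘ F) P μ := by
  rw [map_restrict_eq_map_comap hF hP,
    (measurableEmbedding_domRestrict_of_injOn hF hP hinj).integrable_map_iff,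
    integrableOn_iff_comap_subtypeVal hP]
  rfl

theorem integral_map_restrict (hF : Measurable F) (hP : MeasurableSet P)
    (hinj : Set.InjOn F P) (f : Y → ℝ) :
    ∫ y, f y ∂((μ.restrict P).map F) = ∫ x in P, f (F x) ∂μ := by
  rw [map_restrict_eq_map_comap hF hP,
    (measurableEmbedding_domRestrict_of_injOn hF hP hinj).integral_map,
    ← integral_subtype_comap hP]
  rfl

theorem map_restrict_restrict_of_mapsTo (hF : Measurable F) (hP : MeasurableSet P)
    (hinj : Set.InjOn F P) {S : Set Y} (hS : Set.MapsTo F P S) :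
    ((μ.restrict P).map F).restrict S = (μ.restrict P).map F := by
  refine Measure.restrict_eq_self_of_ae_mem ?_
  rw [map_restrict_eq_map_comap hF hP,
    (measurableEmbedding_domRestrict_of_injOn hF hP hinj).ae_map_iff]
  exact .of_forall fun x => hS x.2

variable {ρ : X → ℝ}

theorem integrableOn_map_withDensity_iff (hF : Measurable F) (hP : MeasurableSet P)
    (hinj : Set.InjOn F P) {S : Set Y} (hS : Set.MapsTo F P S)
    (hρ : AEMeasurable ρ (μ.restrict P)) (hρ0 : ∀ x ∈ P, 0 ≤ ρ x) (f : Y → ℝ) :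
    IntegrableOn f S (((μ.restrict P).withDensity fun x => ENNReal.ofReal (ρ x)).map F) ↔
      IntegrableOn (fun x => ρ x * f (F x)) P μ := by
  rw [← restrict_withDensity hP, IntegrableOn, map_restrict_restrict_of_mapsTo hF hP hinj hS,
    integrable_map_restrict_iff hF hP hinj, IntegrableOn, restrict_withDensity hP,
    integrable_withDensity_iff_integrable_smul₀' hρ.ennreal_ofReal (by simp)]
  refine integrableOn_congr_fun (fun x hx => ?_) hP
  simp [ENNReal.toReal_ofReal (hρ0 x hx)]

theorem setIntegral_map_withDensity (hF : Measurable F) (hP : MeasurableSet P)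
    (hinj : Set.InjOn F P) {S : Set Y} (hS : Set.MapsTo F P S)
    (hρ : AEMeasurable ρ (μ.restrict P)) (hρ0 : ∀ x ∈ P, 0 ≤ ρ x) (f : Y → ℝ) :
    ∫ y in S, f y ∂(((μ.restrict P).withDensity fun x => ENNReal.ofReal (ρ x)).map F) =
      ∫ x in P, ρ x * f (F x) ∂μ := by
  rw [← restrict_withDensity hP, map_restrict_restrict_of_mapsTo hF hP hinj hS,
    integral_map_restrict hF hP hinj, restrict_withDensity hP,
    integral_withDensity_eq_integral_toReal_smul₀ hρ.ennreal_ofReal (by simp)]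
  refine setIntegral_congr_fun hP fun x hx => ?_
  simp [ENNReal.toReal_ofReal (hρ0 x hx)]

end ChangeOfVariables

section GaussianIntegrals

theorem integrableOn_exp_neg_sq_mul_rpow_iff (q : ℝ) :
    IntegrableOn (fun s : ℝ => Real.exp (-s ^ 2) * s ^ q) (Set.Ioi 0) ↔ -1 < q := by
  refine ⟨fun h => ?_, fun hq => (integrableOn_rpow_mul_exp_neg_rpow hq two_pos).congr_fun
    (fun s _ => by simp [mul_comm]) measurableSet_Ioi⟩
  rw [← intervalIntegral.integrableOn_Ioo_rpow_iff (s := q) one_pos]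
  refine ((h.mono_set Set.Ioo_subset_Ioi_self).const_mul (Real.exp 1)).mono'
    (measurable_id'.pow_const q).aestronglyMeasurable ?_
  filter_upwards [ae_restrict_mem measurableSet_Ioo] with s ⟨hs0, hs1⟩
  have hpos : 0 ≤ s ^ q := Real.rpow_nonneg hs0.le q
  rw [Real.norm_of_nonneg hpos, ← mul_assoc, ← Real.exp_add]
  exact le_mul_of_one_le_left hpos (Real.one_le_exp (by nlinarith))

theorem integral_exp_neg_sq_mul_rpow {q : ℝ} (hq : -1 < q) :
    ∫ s in Set.Ioi (0 : ℝ), Real.exp (-s ^ 2) * s ^ q = 2⁻¹ * Real.Gamma ((q + 1) / 2) := by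
  rw [← one_div, ← integral_rpow_mul_exp_neg_rpow two_pos hq]
  exact setIntegral_congr_fun measurableSet_Ioi fun s _ => by simp [mul_comm]

variable (E : Type*) [NormedAddCommGroup E] [InnerProductSpace ℝ E] [FiniteDimensional ℝ E]
  [MeasurableSpace E] [BorelSpace E]

theorem integral_exp_neg_norm_sq :
    ∫ v : E, Real.exp (-‖v‖ ^ 2) = Real.pi ^ (Module.finrank ℝ E / 2 : ℝ) := by
  simpa using GaussianFourier.integral_rexp_neg_mul_sq_norm (V := E) one_pos

theorem integrable_exp_neg_norm_sq : Integrable fun v : E => Real.exp (-‖v‖ ^ 2) :=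
  .of_integral_ne_zero <| by
    rw [integral_exp_neg_norm_sq]
    positivity

end GaussianIntegrals

namespace Vinberg

section Coordinates

theorem fin_two_val_eq_ite (a : Fin 2) : (a : ℕ) = if a = 1 then 1 else 0 := by
  split_ifs <;> omega

variable {I : Type*} [Fintype I] [PartialOrder I] {i : I} {ψ : I → Fin 2}

open Classical in
@[to_additive]
theorem prod_coordIdx {M : Type*} [CommMonoid M] (i : I) (ψ : I → Fin 2) (f : I → I → M) :
    ∏ p : CoordIdx i ψ, f p.1.1 p.1.2 =
      ∏ j with i ≤ j ∧ ψ j = 1, ∏ k with j ≤ k, f k j := by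
  rw [← Finset.prod_subtype (Finset.univ.filter fun p : I × I => i ≤ p.2 ∧ p.2 ≤ p.1 ∧ ψ p.2 = 1)
    (by simp) (fun p => f p.1 p.2), Finset.prod_filter, Fintype.prod_prod_type_right,
    Finset.prod_filter]
  refine Finset.prod_congr rfl fun j _ => ?_
  rw [Finset.prod_filter]
  split_ifs with hj
  · simp [hj]
  · exact Finset.prod_eq_one fun k _ => if_neg fun h => hj ⟨h.1, h.2.2⟩

variable (A : I → I → Type*) [∀ i j, NormedAddCommGroup (A i j)]
  [∀ i j, InnerProductSpace ℝ (A i j)]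

open Classical in
theorem absPsi_eq_card (hψ : ∀ j, ψ j = 1 → i ≤ j) :
    absPsi i ψ = (Finset.univ.filter fun j => ψ j = 1).card := by
  simp only [absPsi, fin_two_val_eq_ite, Finset.sum_boole, Finset.filter_filter, Nat.cast_id]
  congr! 2 with j
  exact and_iff_right_of_imp (hψ j)

open Classical in
theorem absN_eq_sum (hψ : ∀ j, ψ j = 1 → i ≤ j) :
    absN A i ψ = ∑ j with ψ j = 1, ∑ k with j < k, Module.finrank ℝ (A k j) := by
  have hterm (j k : I) : (if i ≤ k then if j < k then
      (ψ j : ℕ) * Module.finrank ℝ (A k j) else 0 else 0) =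
      if ψ j = 1 then if j < k then Module.finrank ℝ (A k j) else 0 else 0 := by
    by_cases hj : ψ j = 1
    · have : j < k → i ≤ k := fun h => (hψ j hj).trans h.le
      grind
    · simp [fin_two_val_eq_ite, hj]
  simp only [absN, nPsi, Finset.sum_filter, Finset.ite_sum_zero, hterm]
  exact Finset.sum_comm

theorem dotChi_of_eq_one {j : I} (hij : i ≤ j) (hj : ψ j = 1) :
    dotChi A i ψ j = -(1 + nPsi A ψ j : ℝ) / 2 := by
  simp [dotChi, hij, hj]

end Coordinates

section EntryIntegrand

variable {I : Type*}

open Classical in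
/-- The exponents of the norms of the coordinates `t_{kj}` in the generalized power of `T T^*` with
multiplier `χ`: only the diagonal coordinates occur. -/
noncomputable def coordExponent (χ : I → ℝ) : Matrix I I ℝ := Matrix.diagonal fun j => 2 * χ j

variable {A : I → I → Type*} [∀ i j, NormedAddCommGroup (A i j)]

/-- The factor of the coordinate `a = t_{kj}` in `e ^ (-tr (T · e_ψ)) Δ_χ(T T^*)`. -/
noncomputable def entryIntegrand (χ : I → ℝ) (k j : I) (a : A k j) : ℝ :=
  Real.exp (-‖a‖ ^ 2) * ‖a‖ ^ coordExponent χ k j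

theorem entryIntegrand_self (χ : I → ℝ) (j : I) :
    entryIntegrand χ j j = fun a : A j j => Real.exp (-‖a‖ ^ 2) * ‖a‖ ^ (2 * χ j) := by
  funext a
  simp [entryIntegrand, coordExponent]

theorem entryIntegrand_of_ne (χ : I → ℝ) {k j : I} (h : k ≠ j) :
    entryIntegrand χ k j = fun a : A k j => Real.exp (-‖a‖ ^ 2) := by
  funext a
  simp [entryIntegrand, coordExponent, h]

variable [∀ i j, MeasurableSpace (A i j)] [∀ i j, BorelSpace (A i j)]

theorem measurable_entryIntegrand (χ : I → ℝ) (k j : I) :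
    Measurable (entryIntegrand χ k j : A k j → ℝ) := by
  unfold entryIntegrand
  fun_prop

end EntryIntegrand

namespace Algebra

variable {I : Type*} [Fintype I] [PartialOrder I]
  {A : I → I → Type*} [∀ i j, NormedAddCommGroup (A i j)] [∀ i j, InnerProductSpace ℝ (A i j)]
  (V : Algebra I A)

theorem diag_self (d : I → ℝ) (i : I) : V.diag d i i = (V.scalar i).symm (d i) := by
  simp [Ops.diag]

theorem diag_of_ne (d : I → ℝ) {i j : I} (h : i ≠ j) : V.diag d i j = 0 := by
  simp [Ops.diag, h.symm]

theorem scalar_one (i : I) : V.scalar i (V.one i i) = 1 := by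
  rw [Ops.one, V.diag_self, LinearEquiv.apply_symm_apply]

theorem one_mem_lowerTri : V.one ∈ lowerTri A :=
  fun _ _ h => V.diag_of_ne _ fun e => h e.ge

theorem mul_diag_apply (X : Mat A) (d : I → ℝ) (i j : I) :
    V.mul X (V.diag d) i j = V.emul i j j (X i j) ((V.scalar j).symm (d j)) := by
  rw [Ops.mul, Finset.sum_eq_single j (fun m _ hm => by simp [V.diag_of_ne _ hm]) (by simp),
    V.diag_self]

theorem emul_diag_entry (i j : I) (a : A i j) (b : A j j) :
    V.emul i j j a b = V.scalar j b • a := by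
  classical
  have hunit : V.emul i j j a ((V.scalar j).symm 1) = a := by
    simpa [Ops.one, V.mul_diag_apply] using
      congrFun₂ (V.mul_one (Pi.single i (Pi.single j a))) i j
  have hb : b = V.scalar j b • (V.scalar j).symm 1 := by simp [← map_smul]
  rw [hb, map_smul, hunit, ← hb]

theorem act_apply (ψ : I → Fin 2) (T : Mat A) (k l : I) :
    V.act ψ T k l = ∑ m, ((ψ m : ℕ) : ℝ) • V.emul k m l (T k m) (V.adj l m (T l m)) := by
  simp only [act, ePsi]
  rw [Ops.mul]
  refine Finset.sum_congr rfl fun m _ => ?_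
  rw [V.mul_diag_apply, V.emul_diag_entry, LinearEquiv.apply_symm_apply, map_smul,
    LinearMap.smul_apply, Ops.star]

theorem act_one (T : Mat A) : V.act (fun _ => 1) T = V.mul T (V.star T) := by
  have hone : V.ePsi (fun _ => 1) = V.one := by simp [ePsi, Ops.one]
  rw [act, hone, V.mul_one]

theorem scalar_emul_adj_self (i j : I) (a : A i j) :
    V.scalar i (V.emul i j i a (V.adj i j a)) = ‖a‖ ^ 2 := by
  rw [← V.inner_eq, real_inner_self_eq_norm_sq]

theorem norm_eq_abs_scalar (i : I) (a : A i i) : ‖a‖ = |V.scalar i a| := by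
  rw [← sq_eq_sq₀ (norm_nonneg _) (abs_nonneg _), ← V.scalar_emul_adj_self, V.adj_diag,
    V.emul_diag_entry, map_smul, smul_eq_mul, sq_abs, sq]

theorem tr_act (ψ : I → Fin 2) (T : Mat A) :
    V.tr (V.act ψ T) = ∑ k, ∑ m, ((ψ m : ℕ) : ℝ) * ‖T k m‖ ^ 2 := by
  simp only [Ops.tr, V.act_apply, map_sum, map_smul, V.scalar_emul_adj_self, smul_eq_mul]

open Classical in
theorem act_apply_of_mem_lowerTri {T : Mat A} (hT : T ∈ lowerTri A) (ψ : I → Fin 2) (k j : I) :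
    V.act ψ T k j = ((ψ j : ℕ) : ℝ) • V.scalar j (T j j) • T k j +
      ∑ m with m < j, ((ψ m : ℕ) : ℝ) • V.emul k m j (T k m) (V.adj j m (T j m)) := by
  have hjj : V.scalar j (T j j) • T k j = V.emul k j j (T k j) (V.adj j j (T j j)) := by
    rw [V.adj_diag, V.emul_diag_entry]
  rw [V.act_apply, hjj, ← sum_filter_le_eq_add_sum_filter_lt
    (fun m => ((ψ m : ℕ) : ℝ) • V.emul k m j (T k m) (V.adj j m (T j m)))]
  refine (Finset.sum_filter_of_ne fun m _ hm => ?_).symm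
  by_contra hmj
  simp [hT j m hmj] at hm

theorem column_eq_of_act_eq {ψ : I → Fin 2} {S T : Mat A} (hS : S ∈ V.lowerTriPos)
    (hT : T ∈ V.lowerTriPos) (h : V.act ψ S = V.act ψ T) (j : I) (hj : ψ j = 1) (k : I) :
    S k j = T k j := by
  classical
  induction j using WellFoundedLT.induction generalizing k with
  | ind j ih =>
  have hprev (k : I) :
      ∑ m with m < j, ((ψ m : ℕ) : ℝ) • V.emul k m j (S k m) (V.adj j m (S j m)) =
        ∑ m with m < j, ((ψ m : ℕ) : ℝ) • V.emul k m j (T k m) (V.adj j m (T j m)) := by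
    refine Finset.sum_congr rfl fun m hm => ?_
    by_cases hm1 : ψ m = 1
    · simp only [ih m (Finset.mem_filter.1 hm).2 hm1]
    · simp [fin_two_val_eq_ite, hm1]
  have hcol (k : I) : V.scalar j (S j j) • S k j = V.scalar j (T j j) • T k j := by
    have hkj := congrFun₂ h k j
    rw [V.act_apply_of_mem_lowerTri hS.1, V.act_apply_of_mem_lowerTri hT.1, hprev] at hkj
    simpa [hj] using hkj
  have hdiag : V.scalar j (S j j) = V.scalar j (T j j) := by
    have hjj := congrArg (V.scalar j) (hcol j)
    simp only [map_smul, smul_eq_mul] at hjj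
    exact (mul_self_inj (hS.2 j).le (hT.2 j).le).1 hjj
  exact smul_right_injective _ (hT.2 j).ne' ((hdiag ▸ hcol k :))

theorem factor_mul_star {T : Mat A} (hT : T ∈ V.lowerTriPos) :
    V.factor (V.mul T (V.star T)) = T := by
  have h : V.mul T (V.star T) ∈ V.cone := ⟨T, hT, rfl⟩
  rw [factor, dif_pos h]
  obtain ⟨hmem, heq⟩ := Exists.choose_spec h
  have hact := (V.act_one T).trans (heq.trans (V.act_one _).symm)
  exact funext₂ fun k j => (V.column_eq_of_act_eq hT hmem hact j rfl k).symm

open Classical in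
theorem genPow_mul_star {T : Mat A} (hT : T ∈ V.lowerTriPos) (i : I) (χ : I → ℝ) :
    V.genPow i χ (V.mul T (V.star T)) = ∏ k with i ≤ k, V.scalar k (T k k) ^ (2 * χ k) := by
  refine Finset.prod_congr rfl fun k _ => ?_
  rw [minorLE, minorLT, V.factor_mul_star hT, prod_filter_le_eq_mul_prod_filter_lt,
    mul_div_cancel_right₀ _ (Finset.prod_ne_zero_iff.2 fun j _ => (pow_pos (hT.2 j) 2).ne'),
    Real.rpow_mul (hT.2 k).le, Real.rpow_two]

theorem genPow_add {T : Mat A} (hT : T ∈ V.lowerTriPos) (i : I) (χ χ' : I → ℝ) :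
    V.genPow i (χ + χ') (V.mul T (V.star T)) =
      V.genPow i χ (V.mul T (V.star T)) * V.genPow i χ' (V.mul T (V.star T)) := by
  simp only [V.genPow_mul_star hT, ← Finset.prod_mul_distrib, Pi.add_apply, mul_add,
    Real.rpow_add (hT.2 _)]

theorem orbitPow_act {i : I} {ψ : I → Fin 2} {χ : I → ℝ}
    (hχ : ∀ j, i ≤ j → ψ j = 0 → χ j = 0) {T : Mat A} (hT : T ∈ V.lowerTriPos) :
    V.orbitPow i ψ χ (V.act ψ T) = V.genPow i χ (V.mul T (V.star T)) := by
  classical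
  have h : V.act ψ T ∈ V.orbit ψ := ⟨T, hT, rfl⟩
  rw [orbitPow, dif_pos h]
  obtain ⟨hmem, heq⟩ := Exists.choose_spec h
  rw [V.genPow_mul_star hmem, V.genPow_mul_star hT]
  refine Finset.prod_congr rfl fun k hk => ?_
  by_cases hk1 : ψ k = 1
  · rw [V.column_eq_of_act_eq hT hmem heq k hk1 k]
  · simp [hχ k (Finset.mem_filter.1 hk).2 (by omega)]

theorem genPow_mul_exp_mul_orbitPow_act {i : I} {ψ : I → Fin 2} {χ : I → ℝ}
    (hχ : ∀ j, i ≤ j → ψ j = 0 → χ j = 0) (χ' : I → ℝ) {T : Mat A} (hT : T ∈ V.lowerTriPos) :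
    V.genPow i χ' (V.mul T (V.star T)) *
        (Real.exp (-V.tr (V.act ψ T)) * V.orbitPow i ψ χ (V.act ψ T)) =
      Real.exp (-V.tr (V.act ψ T)) * V.genPow i (χ' + χ) (V.mul T (V.star T)) := by
  rw [V.orbitPow_act hχ hT, V.genPow_add hT]
  ring

section OfCoord

variable {i : I} {ψ : I → Fin 2}

theorem ofCoord_coe (t : Coord A i ψ) (p : CoordIdx i ψ) :
    V.ofCoord i ψ t p.1.1 p.1.2 = t p :=
  dif_pos p.2

theorem ofCoord_mem_lowerTri (t : Coord A i ψ) : V.ofCoord i ψ t ∈ lowerTri A := fun k j h => by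
  rw [ofCoord, dif_neg fun h' => h h'.2.1]
  exact V.one_mem_lowerTri k j h

theorem ofCoord_mem_lowerTriPos {t : Coord A i ψ} (ht : t ∈ V.posCoord i ψ) :
    V.ofCoord i ψ t ∈ V.lowerTriPos := by
  refine ⟨V.ofCoord_mem_lowerTri t, fun j => ?_⟩
  rw [ofCoord]
  split_ifs with h
  · exact ht j h.1 h.2.2
  · rw [V.scalar_one]; exact one_pos

theorem mapsTo_act_ofCoord (i : I) (ψ : I → Fin 2) :
    Set.MapsTo (fun t => V.act ψ (V.ofCoord i ψ t)) (V.posCoord i ψ) (V.orbit ψ) :=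
  fun _ ht => ⟨_, V.ofCoord_mem_lowerTriPos ht, rfl⟩

theorem injOn_act_ofCoord (i : I) (ψ : I → Fin 2) :
    Set.InjOn (fun t => V.act ψ (V.ofCoord i ψ t)) (V.posCoord i ψ) := by
  intro s hs t ht h
  funext p
  rw [← V.ofCoord_coe s, ← V.ofCoord_coe t]
  exact V.column_eq_of_act_eq (V.ofCoord_mem_lowerTriPos hs) (V.ofCoord_mem_lowerTriPos ht) h _
    p.2.2.2 _

open Classical in
theorem tr_act_ofCoord (hψ : ∀ j, ψ j = 1 → i ≤ j) (t : Coord A i ψ) :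
    V.tr (V.act ψ (V.ofCoord i ψ t)) = ∑ p, ‖t p‖ ^ 2 := by
  simp_rw [V.tr_act, ← V.ofCoord_coe t]
  rw [sum_coordIdx i ψ fun k j => ‖V.ofCoord i ψ t k j‖ ^ 2, Finset.sum_comm, Finset.sum_filter]
  refine Finset.sum_congr rfl fun j _ => ?_
  by_cases hj : ψ j = 1
  · rw [if_pos ⟨hψ j hj, hj⟩, Finset.sum_filter_of_ne fun k _ hk => ?_]
    · simp [hj]
    · by_contra hjk
      simp [V.ofCoord_mem_lowerTri t k j hjk] at hk
  · simp [hj, fin_two_val_eq_ite]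

open Classical in
theorem genPow_ofCoord {t : Coord A i ψ} (ht : t ∈ V.posCoord i ψ) (χ : I → ℝ) :
    V.genPow i χ (V.mul (V.ofCoord i ψ t) (V.star (V.ofCoord i ψ t))) =
      ∏ p, ‖t p‖ ^ coordExponent χ p.1.1 p.1.2 := by
  have hT := V.ofCoord_mem_lowerTriPos ht
  simp_rw [V.genPow_mul_star hT, ← V.ofCoord_coe t]
  rw [prod_coordIdx i ψ fun k j => ‖V.ofCoord i ψ t k j‖ ^ coordExponent χ k j,
    ← Finset.filter_filter, Finset.prod_filter (fun j => ψ j = 1)]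
  refine Finset.prod_congr rfl fun j _ => ?_
  split_ifs with hj
  · rw [Finset.prod_eq_single_of_mem j (by simp) fun k _ hk => ?_]
    · rw [coordExponent, Matrix.diagonal_apply_eq, V.norm_eq_abs_scalar, abs_of_pos (hT.2 j)]
    · rw [coordExponent, Matrix.diagonal_apply_ne _ hk, Real.rpow_zero]
  · rw [ofCoord, dif_neg (by simp [hj]), V.scalar_one, Real.one_rpow]

theorem genPow_ofCoord_nonneg {t : Coord A i ψ} (ht : t ∈ V.posCoord i ψ) (χ : I → ℝ) :
    0 ≤ V.genPow i χ (V.mul (V.ofCoord i ψ t) (V.star (V.ofCoord i ψ t))) := by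
  classical
  rw [V.genPow_ofCoord ht]
  positivity

theorem continuous_ofCoord (i : I) (ψ : I → Fin 2) : Continuous (V.ofCoord i ψ) := by
  refine continuous_pi fun k => continuous_pi fun j => ?_
  unfold ofCoord
  split_ifs <;> fun_prop

end OfCoord

section PosEntry

/-- The entries `t_{kj}` allowed in `𝒯_l^+`: positive ones if `k = j`, and all of `A k j`
otherwise. -/
def posEntry (k j : I) : Set (A k j) :=
  {a | ∀ h : k = j, 0 < V.scalar j (h ▸ a)}

theorem posEntry_self (j : I) : V.posEntry j j = {a | 0 < V.scalar j a} := by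
  simp [posEntry]

theorem posEntry_of_ne {k j : I} (h : k ≠ j) : V.posEntry k j = Set.univ := by
  simp [posEntry, h]

theorem posEntry_nonempty (k j : I) : (V.posEntry k j).Nonempty := by
  obtain rfl | h := eq_or_ne k j
  · rw [V.posEntry_self]
    exact ⟨(V.scalar k).symm 1, by simp⟩
  · rw [V.posEntry_of_ne h]
    exact Set.univ_nonempty

theorem posCoord_eq_pi (i : I) (ψ : I → Fin 2) :
    V.posCoord i ψ = Set.univ.pi fun p : CoordIdx i ψ => V.posEntry p.1.1 p.1.2 := by
  ext t
  refine ⟨?_, fun ht j hi hj => ht ⟨(j, j), hi, le_rfl, hj⟩ (Set.mem_univ _) rfl⟩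
  rintro ht ⟨⟨k, j⟩, hi, hjk, hj⟩ - (rfl : k = j)
  exact ht k hi hj

/-- The identification of a diagonal entry with a real number, as an isometry. -/
def scalarIsometry (j : I) : A j j ≃ₗᵢ[ℝ] ℝ where
  toLinearEquiv := V.scalar j
  norm_map' a := (V.norm_eq_abs_scalar j a).symm

theorem isOpen_posEntry (k j : I) : IsOpen (V.posEntry k j) := by
  obtain rfl | h := eq_or_ne k j
  · rw [V.posEntry_self]
    exact isOpen_lt continuous_const (V.scalarIsometry k).continuous
  · rw [V.posEntry_of_ne h]
    exact isOpen_univ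

end PosEntry

section EntryIntegrals

theorem entryIntegrand_pos (χ : I → ℝ) {k j : I} {a : A k j} (ha : a ∈ V.posEntry k j) :
    0 < entryIntegrand χ k j a := by
  obtain rfl | h := eq_or_ne k j
  · rw [V.posEntry_self] at ha
    have hnorm : 0 < ‖a‖ := by
      rw [V.norm_eq_abs_scalar]
      exact abs_pos_of_pos ha
    unfold entryIntegrand
    positivity
  · rw [entryIntegrand_of_ne χ h]
    positivity

open Classical in
theorem exp_neg_tr_mul_genPow_ofCoord {i : I} {ψ : I → Fin 2} (hψ : ∀ j, ψ j = 1 → i ≤ j)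
    (χ : I → ℝ) {t : Coord A i ψ} (ht : t ∈ V.posCoord i ψ) :
    Real.exp (-V.tr (V.act ψ (V.ofCoord i ψ t))) *
        V.genPow i χ (V.mul (V.ofCoord i ψ t) (V.star (V.ofCoord i ψ t))) =
      ∏ p, entryIntegrand χ p.1.1 p.1.2 (t p) := by
  simp only [V.tr_act_ofCoord hψ, V.genPow_ofCoord ht, entryIntegrand, Finset.prod_mul_distrib,
    ← Real.exp_sum, Finset.sum_neg_distrib]

theorem entryIntegrand_self_eqOn (χ : I → ℝ) (j : I) :
    Set.EqOn (entryIntegrand χ j j)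
      (fun a => Real.exp (-V.scalarIsometry j a ^ 2) * V.scalarIsometry j a ^ (2 * χ j))
      (V.posEntry j j) := by
  intro a ha
  rw [V.posEntry_self] at ha
  have hnorm : ‖a‖ = V.scalarIsometry j a := by
    rw [V.norm_eq_abs_scalar]
    exact abs_of_pos ha
  simp only [entryIntegrand_self, hnorm]

variable [∀ i j, MeasurableSpace (A i j)] [∀ i j, BorelSpace (A i j)]

theorem measurableSet_posCoord (i : I) (ψ : I → Fin 2) : MeasurableSet (V.posCoord i ψ) := by
  rw [V.posCoord_eq_pi]
  exact .univ_pi fun p => (V.isOpen_posEntry _ _).measurableSet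

variable [∀ i j, FiniteDimensional ℝ (A i j)]

open Classical in
theorem restrict_posCoord (i : I) (ψ : I → Fin 2) :
    (volume : Measure (Coord A i ψ)).restrict (V.posCoord i ψ) =
      Measure.pi fun p : CoordIdx i ψ => volume.restrict (V.posEntry p.1.1 p.1.2) := by
  rw [V.posCoord_eq_pi, volume_pi, Measure.restrict_pi_pi]

theorem measurePreserving_scalarIsometry_restrict (j : I) :
    MeasurePreserving (V.scalarIsometry j) (volume.restrict (V.posEntry j j))
      (volume.restrict (Set.Ioi 0)) := by
  rw [V.posEntry_self]
  exact (V.scalarIsometry j).measurePreserving.restrict_preimage measurableSet_Ioi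

theorem integrableOn_entryIntegrand_iff (χ : I → ℝ) (k j : I) :
    IntegrableOn (entryIntegrand χ k j) (V.posEntry k j) ↔ (k = j → -(1 / 2) < χ j) := by
  obtain rfl | h := eq_or_ne k j
  · rw [integrableOn_congr_fun (V.entryIntegrand_self_eqOn χ k)
        (V.isOpen_posEntry k k).measurableSet, IntegrableOn,
      ← Function.comp_def (fun s => Real.exp (-s ^ 2) * s ^ (2 * χ k)) (V.scalarIsometry k),
      (V.measurePreserving_scalarIsometry_restrict k).integrable_comp_emb
        (V.scalarIsometry k).toHomeomorph.measurableEmbedding,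
      ← IntegrableOn, integrableOn_exp_neg_sq_mul_rpow_iff]
    grind
  · simpa [V.posEntry_of_ne h, entryIntegrand_of_ne χ h, h] using integrable_exp_neg_norm_sq _

theorem integral_entryIntegrand_self {χ : I → ℝ} {j : I} (hχ : -(1 / 2) < χ j) :
    ∫ a in V.posEntry j j, entryIntegrand χ j j a = 2⁻¹ * Real.Gamma (χ j + 1 / 2) := by
  rw [setIntegral_congr_fun (V.isOpen_posEntry j j).measurableSet
      (V.entryIntegrand_self_eqOn χ j),
    (V.measurePreserving_scalarIsometry_restrict j).integral_comp
      (V.scalarIsometry j).toHomeomorph.measurableEmbedding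
      fun s => Real.exp (-s ^ 2) * s ^ (2 * χ j),
    integral_exp_neg_sq_mul_rpow (by linarith)]
  congr 2
  ring

theorem integral_entryIntegrand_of_ne (χ : I → ℝ) {k j : I} (h : k ≠ j) :
    ∫ a in V.posEntry k j, entryIntegrand χ k j a =
      Real.pi ^ (Module.finrank ℝ (A k j) / 2 : ℝ) := by
  rw [V.posEntry_of_ne h, entryIntegrand_of_ne χ h, setIntegral_univ, integral_exp_neg_norm_sq]

theorem not_entryIntegrand_ae_eq_zero (χ : I → ℝ) (k j : I) :
    ¬ entryIntegrand χ k j =ᵐ[volume.restrict (V.posEntry k j)] 0 := by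
  intro h0
  have hmem := ae_restrict_mem (μ := volume) (V.isOpen_posEntry k j).measurableSet
  have hfalse : ∀ᵐ _ ∂(volume.restrict (V.posEntry k j)), False := by
    filter_upwards [h0, hmem] with a ha0 ha using (V.entryIntegrand_pos χ ha).ne' ha0
  rw [ae_iff] at hfalse
  exact ((V.isOpen_posEntry k j).measure_pos volume (V.posEntry_nonempty k j)).ne'
    (by simpa using hfalse)

end EntryIntegrals

section Measures

variable {i : I} {ψ : I → Fin 2}

theorem act_zero (T : Mat A) : V.act 0 T = 0 := by
  funext k l
  simp [V.act_apply]

variable [∀ i j, FiniteDimensional ℝ (A i j)]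

theorem continuous_act (ψ : I → Fin 2) : Continuous (V.act ψ) := by
  refine continuous_pi fun k => continuous_pi fun l => ?_
  simp_rw [V.act_apply]
  refine continuous_finsetSum _ fun m _ => .const_smul ?_ _
  have hmul : Continuous fun a : A k m => LinearMap.toContinuousLinearMap (V.emul k m l a) :=
    (LinearMap.toContinuousLinearMap.toLinearMap ∘ₗ V.emul k m l).continuous_of_finiteDimensional
  have hadj := (V.adj l m).continuous_of_finiteDimensional
  exact (hmul.comp (continuous_apply_apply k m)).clm_apply
    (hadj.comp (continuous_apply_apply l m))

variable [∀ i j, MeasurableSpace (A i j)] [∀ i j, BorelSpace (A i j)]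

theorem measurable_act_ofCoord (i : I) (ψ : I → Fin 2) :
    Measurable fun t => V.act ψ (V.ofCoord i ψ t) :=
  ((V.continuous_act ψ).comp (V.continuous_ofCoord i ψ)).measurable

open Classical in
theorem aemeasurable_genPow_ofCoord (i : I) (ψ : I → Fin 2) (χ : I → ℝ) :
    AEMeasurable
      (fun t => V.genPow i χ (V.mul (V.ofCoord i ψ t) (V.star (V.ofCoord i ψ t))))
      ((volume : Measure (Coord A i ψ)).restrict (V.posCoord i ψ)) := by
  have hmonomial : Measurable fun t : Coord A i ψ => ∏ p, ‖t p‖ ^ coordExponent χ p.1.1 p.1.2 := by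
    fun_prop
  refine hmonomial.aemeasurable.congr ?_
  filter_upwards [ae_restrict_mem (V.measurableSet_posCoord i ψ)] with t ht
  exact (V.genPow_ofCoord ht χ).symm

open Classical in
theorem nu_eq_map (i : I) (ψ : I → Fin 2) :
    V.nu i ψ = ((volume.restrict (V.posCoord i ψ)).withDensity fun t => ENNReal.ofReal
      (V.genPow i (dotChi A i ψ) (V.mul (V.ofCoord i ψ t) (V.star (V.ofCoord i ψ t))))).map
        fun t => V.act ψ (V.ofCoord i ψ t) := by
  rw [nu]
  split_ifs with h
  · subst h
    have : IsEmpty (CoordIdx i (0 : I → Fin 2)) := ⟨fun p => by simpa using p.2.2.2⟩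
    have huniv : V.posCoord i (0 : I → Fin 2) = Set.univ := by simp [posCoord]
    have hgenPow (t : Coord A i 0) : V.genPow i (dotChi A i 0)
        (V.mul (V.ofCoord i 0 t) (V.star (V.ofCoord i 0 t))) = 1 := by
      rw [V.genPow_ofCoord (huniv ▸ Set.mem_univ t), Finset.prod_of_isEmpty]
    simp [V.act_zero, huniv, hgenPow, volume_pi]
  · rfl

open Classical in
theorem integrableOn_nu_iff (f : Mat A → ℝ) :
    IntegrableOn f (V.orbit ψ) (V.nu i ψ) ↔ IntegrableOn (fun t =>
      V.genPow i (dotChi A i ψ) (V.mul (V.ofCoord i ψ t) (V.star (V.ofCoord i ψ t))) *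
        f (V.act ψ (V.ofCoord i ψ t))) (V.posCoord i ψ) := by
  rw [V.nu_eq_map, integrableOn_map_withDensity_iff (V.measurable_act_ofCoord i ψ)
    (V.measurableSet_posCoord i ψ) (V.injOn_act_ofCoord i ψ) (V.mapsTo_act_ofCoord i ψ)
    (V.aemeasurable_genPow_ofCoord i ψ _) fun _ ht => V.genPow_ofCoord_nonneg ht _]

open Classical in
theorem setIntegral_nu (f : Mat A → ℝ) :
    ∫ Z in V.orbit ψ, f Z ∂(V.nu i ψ) = ∫ t in V.posCoord i ψ,
      V.genPow i (dotChi A i ψ) (V.mul (V.ofCoord i ψ t) (V.star (V.ofCoord i ψ t))) *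
        f (V.act ψ (V.ofCoord i ψ t)) := by
  rw [V.nu_eq_map, setIntegral_map_withDensity (V.measurable_act_ofCoord i ψ)
    (V.measurableSet_posCoord i ψ) (V.injOn_act_ofCoord i ψ) (V.mapsTo_act_ofCoord i ψ)
    (V.aemeasurable_genPow_ofCoord i ψ _) fun _ ht => V.genPow_ofCoord_nonneg ht _]

variable {χ : I → ℝ}

open Classical in
theorem integrableOn_exp_neg_tr_mul_genPow_iff (hψ : ∀ j, ψ j = 1 → i ≤ j) :
    IntegrableOn (fun t => Real.exp (-V.tr (V.act ψ (V.ofCoord i ψ t))) *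
        V.genPow i χ (V.mul (V.ofCoord i ψ t) (V.star (V.ofCoord i ψ t)))) (V.posCoord i ψ) ↔
      ∀ j, ψ j = 1 → -(1 / 2) < χ j := by
  rw [integrableOn_congr_fun (fun t ht => V.exp_neg_tr_mul_genPow_ofCoord hψ χ ht)
    (V.measurableSet_posCoord i ψ), IntegrableOn, restrict_posCoord,
    integrable_fintype_prod_iff (fun _ => measurable_entryIntegrand χ _ _)
      fun _ => V.not_entryIntegrand_ae_eq_zero χ _ _]
  refine (forall_congr' fun p => V.integrableOn_entryIntegrand_iff χ _ _).trans ?_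
  exact ⟨fun h j hj => h ⟨(j, j), hψ j hj, le_rfl, hj⟩ rfl, fun h p _ => h _ p.2.2.2⟩

open Classical in
theorem setIntegral_exp_neg_tr_mul_genPow (hψ : ∀ j, ψ j = 1 → i ≤ j)
    (hχ : ∀ j, ψ j = 1 → -(1 / 2) < χ j) :
    ∫ t in V.posCoord i ψ, Real.exp (-V.tr (V.act ψ (V.ofCoord i ψ t))) *
        V.genPow i χ (V.mul (V.ofCoord i ψ t) (V.star (V.ofCoord i ψ t))) =
      (2 : ℝ) ^ (-(absPsi i ψ : ℝ)) * Real.pi ^ ((absN A i ψ : ℝ) / 2) *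
        ∏ j with ψ j = 1, Real.Gamma (χ j + 1 / 2) := by
  have hoffdiag (j k : I) (hk : k ∈ Finset.univ.filter (j < ·)) :
      ∫ a in V.posEntry k j, entryIntegrand χ k j a =
        Real.pi ^ (Module.finrank ℝ (A k j) / 2 : ℝ) :=
    V.integral_entryIntegrand_of_ne χ (Finset.mem_filter.1 hk).2.ne'
  have hcolumn (j : I) (hj : ψ j = 1) :
      ∏ k with j ≤ k, ∫ a in V.posEntry k j, entryIntegrand χ k j a =
        2⁻¹ * Real.Gamma (χ j + 1 / 2) *
          Real.pi ^ ((∑ k with j < k, Module.finrank ℝ (A k j) : ℕ) / 2 : ℝ) := by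
    rw [prod_filter_ge_eq_mul_prod_filter_gt, V.integral_entryIntegrand_self (hχ j hj),
      Finset.prod_congr rfl (hoffdiag j), ← Real.rpow_sum_of_pos Real.pi_pos, ← Finset.sum_div,
      Nat.cast_sum]
  calc
    _ = ∏ p : CoordIdx i ψ, ∫ a in V.posEntry p.1.1 p.1.2, entryIntegrand χ p.1.1 p.1.2 a := by
      rw [setIntegral_congr_fun (V.measurableSet_posCoord i ψ) fun t ht =>
        V.exp_neg_tr_mul_genPow_ofCoord hψ χ ht, restrict_posCoord,
        integral_fintype_prod_eq_prod]
    _ = ∏ j with ψ j = 1, (2⁻¹ * Real.Gamma (χ j + 1 / 2) *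
          Real.pi ^ ((∑ k with j < k, Module.finrank ℝ (A k j) : ℕ) / 2 : ℝ)) := by
      rw [prod_coordIdx i ψ fun k j => ∫ a in V.posEntry k j, entryIntegrand χ k j a]
      refine Finset.prod_congr (by ext j; simpa using hψ j) fun j hj => ?_
      exact hcolumn j (Finset.mem_filter.1 hj).2
    _ = _ := by
      rw [Finset.prod_mul_distrib, Finset.prod_mul_distrib, Finset.prod_const,
        ← Real.rpow_sum_of_pos Real.pi_pos, ← Finset.sum_div, ← Nat.cast_sum,
        ← absN_eq_sum A hψ, ← absPsi_eq_card hψ, Real.rpow_neg zero_le_two, Real.rpow_natCast,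
        inv_pow]
      ring

end Measures
end Algebra
end Vinberg

theorem theorem3p2 {I : Type*} [Fintype I] [PartialOrder I] {A : I → I → Type*}
    [∀ i j, NormedAddCommGroup (A i j)] [∀ i j, InnerProductSpace ℝ (A i j)]
    [∀ i j, FiniteDimensional ℝ (A i j)] [∀ i j, MeasurableSpace (A i j)]
    [∀ i j, BorelSpace (A i j)] (V : Vinberg.Algebra I A)
    (i : I) (ψ : I → Fin 2) (hψ : ∀ j, ¬ i ≤ j → ψ j = 0)
    (χ : I → ℝ) (hχ : χ ∈ Vinberg.multipliers i ψ) :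
    (MeasureTheory.IntegrableOn (fun Z => Real.exp (-V.tr Z) * V.orbitPow i ψ χ Z)
        (V.orbit ψ) (V.nu i ψ) ↔
      ∀ j, ψ j = 1 → (Vinberg.nPsi A ψ j : ℝ) / 2 < χ j) ∧
    ((∀ j, ψ j = 1 → (Vinberg.nPsi A ψ j : ℝ) / 2 < χ j) →
      ∫ Z in V.orbit ψ, Real.exp (-V.tr Z) * V.orbitPow i ψ χ Z ∂(V.nu i ψ) =
        (2 : ℝ) ^ (-(Vinberg.absPsi i ψ : ℝ)) *
          Real.pi ^ ((Vinberg.absN A i ψ : ℝ) / 2) *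
          ∏ j with ψ j = 1, Real.Gamma (χ j - (Vinberg.nPsi A ψ j : ℝ) / 2)) := by
  have hψ' (j : I) (hj : ψ j = 1) : i ≤ j := by_contra fun h => by simp [hψ j h] at hj
  have hdot (j : I) (hj : ψ j = 1) :
      (Vinberg.dotChi A i ψ + χ) j = χ j - (Vinberg.nPsi A ψ j : ℝ) / 2 - 1 / 2 := by
    rw [Pi.add_apply, Vinberg.dotChi_of_eq_one A (hψ' j hj) hj]
    ring
  have hconv : (∀ j, ψ j = 1 → -(1 / 2) < (Vinberg.dotChi A i ψ + χ) j) ↔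
      ∀ j, ψ j = 1 → (Vinberg.nPsi A ψ j : ℝ) / 2 < χ j :=
    forall₂_congr fun j hj => by rw [hdot j hj]; constructor <;> intro h <;> linarith
  have hP := V.measurableSet_posCoord i ψ
  have hintegrand (t : Vinberg.Coord A i ψ) (ht : t ∈ V.posCoord i ψ) :=
    V.genPow_mul_exp_mul_orbitPow_act hχ.2 (Vinberg.dotChi A i ψ) (V.ofCoord_mem_lowerTriPos ht)
  constructor
  · rw [V.integrableOn_nu_iff, integrableOn_congr_fun hintegrand hP,
      V.integrableOn_exp_neg_tr_mul_genPow_iff hψ', hconv]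
  · intro h
    rw [V.setIntegral_nu, setIntegral_congr_fun hP hintegrand,
      V.setIntegral_exp_neg_tr_mul_genPow hψ' (hconv.2 h)]
    congr 1
    refine Finset.prod_congr rfl fun j hj => ?_
    rw [hdot j (Finset.mem_filter.1 hj).2, sub_add_cancel]
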